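/- **Setting.** Let $(\Theta,\|\cdot\|)$ be a Banach space with its Borel $\sigma$-algebra. For each $n$ let $P_\theta^n$, $\theta\in\Theta$, be probability measures on a measurable space $\mathcal X_n$ with densities $p_\theta^n(x)<\infty$, jointly measurable in $(\theta,x)$, with respect to a $\sigma$-finite measure $\mu_n$; write $\ell_n(\theta)=\log p^n_\theta$. Let $\Lambda\subset\mathbb R^k$, let $\Pi(\cdot|\lambda)$, $\lambda\in\Lambda$, be priors on $\Theta$ (measurable in $\lambda$), let $\Lambda_n\subset\Lambda$, and put $$\bar m(x|\lambda)=\int p^n_\theta(x)\,d\Pi(\theta|\lambda),\qquad \Pi(B|x;\lambda)=\frac{\int_B p^n_\theta(x)\,d\Pi(\theta|\lambda)}{\bar m(x|\lambda)} .$$ Let $\hat\lambda_n:\mathcal X_n\to\Lambda$ be measurable with, for all large $n$ and all $x$, $\hat\lambda_n(x)\in\Lambda_n$ and $\bar m(x|\hat\lambda_n(x))=\max_{\lambda\in\Lambda_n}\bar m(x|\lambda)$ (MMLE). Fix $\theta_0\in\Theta$, $K>0$, $\tilde c_0\ge1$ and numbers $\epsilon_n(\lambda)\ge 0$ such that, for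 all large $n$ and all $\lambda\in\Lambda_n$, $$\tilde c_0^{-1}n\epsilon_n(\lambda)^2\le-\log\Pi(\theta:\|\theta-\theta_0\|\le K\epsilon_n(\lambda)\,|\,\lambda)\le\tilde c_0\,n\epsilon_n(\lambda)^2 .$$ Let $m_n\to\infty$, $M_n\to\infty$, $u_n\to0$ and $$\epsilon_{n,0}^2=\inf\{\epsilon_n(\lambda)^2:\lambda\in\Lambda_n,\ \epsilon_n(\lambda)^2\ge m_n(\log n)/n\}\vee m_n(\log n)/n,\qquad \Lambda_0=\{\lambda\in\Lambda_n:\epsilon_n(\lambda)\le M_n\epsilon_{n,0}\},$$ where $\epsilon_{n,0}^2=m_n(\log n)/n$ if the set in the infimum is empty. Let $\rho:\Lambda_n\times\Lambda_n\to[0,\infty)$ be a loss function, and for $\lambda,\lambda'\in\Lambda_n$ let $\psi_{\lambda,\lambda'}:\Theta\to\Theta$ be a measurable map carrying $\Pi(\cdot|\lambda)$ to $\Pi(\cdot|\lambda')$ ($\rho$ and $\psi$ may depend on $n$). Let $Q^\theta_{\lambda,n}$ be the measure with $\mu_n$-density $q^\theta_{\lambda,n}(x)=\sup\{p^n_{\psi_{\lambda,\lambda'}(\theta)}(x):\lambda'\in\Lambda_n,\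 \rho(\lambda,\lambda')\le u_n\}$, assumed jointly measurable in $(\theta,x)$. Let $d$ be a semimetric on $\Theta$ (symmetric, zero on the diagonal, satisfying the triangle inequality) with $d(\cdot,\theta_0)$ measurable. $N(r,A,d)$ is the least number of $d$-balls of radius $r$ with centres in $A$ covering $A$, and $N_n(\Lambda_0)$ is the least number of sets $\{\lambda':\rho(\lambda,\lambda')\le u_n\}$ with $\lambda\in\Lambda_0$ covering $\Lambda_0$. Let $K(\theta_0,\theta)$ be the Kullback–Leibler divergence $\mathrm{KL}(P^n_{\theta_0}\|P^n_\theta)$, $V_2(\theta_0,\theta)=E^n_{\theta_0}|\ell_n(\theta_0)-\ell_n(\theta)-K(\theta_0,\theta)|^2$ and $B(\theta_0,\epsilon,2)=\{\theta:K(\theta_0,\theta)\le n\epsilon^2,\ V_2(\theta_0,\theta)\le n\epsilon^2\}$. **Conditions.** (B1) There are constants $M_1>0$, $M_2\ge1$ and, for all large $n$, sets $\tilde\Lambda_0\subset\Lambda_0$ such that $\{\|\theta-\theta_0\|\le K\epsilon_n(\lambda)\}\subset B(\theta_0,M_2\epsilon_n(\lambda),2)$ for every $\lambda\in\tilde\Lambda_0$,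 and $\epsilon_n(\lambda_0)\le M_1\epsilon_{n,0}$ for some $\lambda_0\in\tilde\Lambda_0$. For every $c_2>0$ there are $N$, sets $\Theta_n(\lambda)\subset\Theta$, and constants $c_1,\zeta\in(0,1)$ and $M',C_0>0$ such that for all $n\ge N$ and $\lambda\in\Lambda_0$: (C1) $\Theta_n(\lambda)$ is measurable and $\int_{\Theta_n(\lambda)^c}Q^\theta_{\lambda,n}(\mathcal X_n)\,d\Pi(\theta|\lambda)\le e^{-c_2n\epsilon_{n,0}^2}$. (C2) For every $\theta\in\Theta_n(\lambda)$ there is a test $\phi:\mathcal X_n\to[0,1]$ with $$E^n_{\theta_0}\phi\le e^{-c_1nd(\theta,\theta_0)^2},\qquad \sup_{\theta':\,d(\theta,\theta')\le\zeta d(\theta,\theta_0)}Q^{\theta'}_{\lambda,n}(1-\phi)\le e^{-c_1nd(\theta,\theta_0)^2},$$ and $\log N\big(\zeta u,\{u\le d(\theta,\theta_0)\le2u\}\cap\Theta_n(\lambda),d\big)\le c_1nu^2/2$ for all $u\ge M'M_n\epsilon_{n,0}$. (C3) $\sup_{\lambda'\in\Lambda_n,\ \rho(\lambda,\lambda')\le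 u_n}d(\theta,\psi_{\lambda,\lambda'}(\theta))\le C_0M_n\epsilon_{n,0}$ for every $\theta\in\Theta_n(\lambda)$ with $d(\theta_0,\theta)\le M'M_n\epsilon_{n,0}$. **Claim.** Assume that $P^n_{\theta_0}(\hat\lambda_n\in\Lambda_0)\to1$, that (B1) and (C1)–(C3) hold, and that $\log N_n(\Lambda_0)\le Cn\epsilon_{n,0}^2$ for some constant $C$ and all large $n$. Then there is a constant $M>0$ such that $$E^n_{\theta_0}\,\Pi\big(\theta:d(\theta,\theta_0)\ge MM_n\epsilon_{n,0}\,\big|\,\mathbf x_n;\hat\lambda_n\big)\to0\qquad(n\to\infty).$$ -/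

import Mathlib

open MeasureTheory ProbabilityTheory Filter Topology
open scoped ENNReal NNReal

/-- The minimal number of balls `{a | D t a ≤ r}` with centre `t ∈ A` that are needed to cover
the set `A` (`⊤` if no finite number suffices).  The function `D` need not be a metric. -/
noncomputable def coveringNumberOf {α : Type*} (D : α → α → ℝ) (r : ℝ) (A : Set α) : ℕ∞ :=
  ⨅ (T : Set α) (_ : T ⊆ A) (_ : ∀ a ∈ A, ∃ t ∈ T, D t a ≤ r), T.encard

/-- A semi-metric: a real function with all the properties of a metric, except that distinct
points may have distance zero. -/
structure IsSemimetric {α : Type*} (D : α → α → ℝ) : Prop where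
  self : ∀ x, D x x = 0
  symm : ∀ x y, D x y = D y x
  triangle : ∀ x y z, D x z ≤ D x y + D y z

/-- The set-up of empirical Bayes inference: a dominated sequence of experiments with parameter
space `Θ`, a family of priors on `Θ` indexed by `Λ ⊆ ℝ^k`, the sets `Λ_n ⊆ Λ` over which the
marginal likelihood is maximized, the transformations `ψ` between the priors, the loss `ρ` on
hyper-parameters with the radii `u_n`, the true parameter `θ₀`, the semi-metric `d` on `Θ`,
the rates `ε_n(λ)` and the sequences `m_n`, `M_n`. -/
structure EBSetup (Θ : Type*) [NormedAddCommGroup Θ] [MeasurableSpace Θ]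
    (𝒳 : ℕ → Type*) [∀ n, MeasurableSpace (𝒳 n)]
    {k : ℕ} (Λ : Set (EuclideanSpace ℝ (Fin k))) where
  /-- the dominating measures -/
  μ : ∀ n, Measure (𝒳 n)
  sigmaFinite_μ : ∀ n, SigmaFinite (μ n)
  /-- the densities -/
  p : ∀ n, Θ → 𝒳 n → ℝ≥0
  measurable_p : ∀ n, Measurable (Function.uncurry (p n))
  lintegral_p : ∀ n θ, ∫⁻ x, p n θ x ∂(μ n) = 1
  /-- the priors `Π(· | λ)` -/
  prior : Kernel Λ Θ
  isMarkov_prior : IsMarkovKernel prior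
  /-- the sets `Λ_n` of hyper-parameters -/
  Λn : ℕ → Set Λ
  /-- the loss function on `Λ_n`; its values outside `Λ_n` play no role -/
  ρ : ℕ → Λ → Λ → ℝ≥0
  u : ℕ → ℝ
  tendsto_u : Tendsto u atTop (𝓝 0)
  /-- the changes of measure: `ψ n l l'` carries `Π(· | l)` to `Π(· | l')` -/
  ψ : ℕ → Λ → Λ → Θ → Θ
  measurePreserving_ψ : ∀ n, ∀ l ∈ Λn n, ∀ l' ∈ Λn n,
    MeasurePreserving (ψ n l l') (prior l) (prior l')
  /-- the perturbed likelihoods `q` are measurable in parameter and observation -/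
  measurable_sup : ∀ n, ∀ l ∈ Λn n, Measurable (Function.uncurry fun (θ : Θ) (x : 𝒳 n) =>
    ⨆ l' ∈ Λn n, ⨆ _ : (ρ n l l' : ℝ) ≤ u n, (p n (ψ n l l' θ) x : ℝ≥0∞))
  /-- the true parameter -/
  θ₀ : Θ
  d : Θ → Θ → ℝ
  isSemimetric_d : IsSemimetric d
  measurable_d : Measurable fun θ => d θ θ₀
  K : ℝ
  K_pos : 0 < K
  /-- the constant of comparison in the definition of the rates (`1` if that holds exactly) -/
  c₀ : ℝ
  one_le_c₀ : 1 ≤ c₀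
  /-- the rates `ε_n(λ)` -/
  ε : ℕ → Λ → ℝ
  ε_nonneg : ∀ n l, 0 ≤ ε n l
  /-- `c₀⁻¹ n ε_n(λ)² ≤ - log Π(‖θ - θ₀‖ ≤ K ε_n(λ) | λ) ≤ c₀ n ε_n(λ)²`, in exponential form -/
  prior_ball : ∀ᶠ n : ℕ in atTop, ∀ l ∈ Λn n,
    Real.exp (-(c₀ * n * ε n l ^ 2)) ≤ (prior l).real {θ | ‖θ - θ₀‖ ≤ K * ε n l} ∧
    (prior l).real {θ | ‖θ - θ₀‖ ≤ K * ε n l} ≤ Real.exp (-(c₀⁻¹ * n * ε n l ^ 2))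
  m : ℕ → ℝ
  tendsto_m : Tendsto m atTop atTop
  M : ℕ → ℝ
  tendsto_M : Tendsto M atTop atTop

namespace EBSetup

variable {Θ : Type*} [NormedAddCommGroup Θ] [MeasurableSpace Θ]
  {𝒳 : ℕ → Type*} [∀ n, MeasurableSpace (𝒳 n)]
  {k : ℕ} {Λ : Set (EuclideanSpace ℝ (Fin k))}

/-- The distribution `P_θ^n` of the observation. -/
noncomputable def P (S : EBSetup Θ 𝒳 Λ) (n : ℕ) (θ : Θ) : Measure (𝒳 n) :=
  (S.μ n).withDensity fun x => (S.p n θ x : ℝ≥0∞)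

/-- The marginal likelihood `∫ p_θ^n(x) dΠ(θ | λ)`. -/
noncomputable def marginal (S : EBSetup Θ 𝒳 Λ) (n : ℕ) (l : Λ) (x : 𝒳 n) : ℝ≥0∞ :=
  ∫⁻ θ, (S.p n θ x : ℝ≥0∞) ∂(S.prior l)

/-- The posterior probability `Π(B | x ; λ)` of `B`. -/
noncomputable def posterior (S : EBSetup Θ 𝒳 Λ) (n : ℕ) (l : Λ) (x : 𝒳 n) (B : Set Θ) : ℝ≥0∞ :=
  (∫⁻ θ in B, (S.p n θ x : ℝ≥0∞) ∂(S.prior l)) / S.marginal n l x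

/-- `f` is a marginal maximum likelihood estimator for the observation with index `n`. -/
def IsMMLE (S : EBSetup Θ 𝒳 Λ) (n : ℕ) (f : 𝒳 n → Λ) : Prop :=
  ∀ x, f x ∈ S.Λn n ∧ ∀ l ∈ S.Λn n, S.marginal n l x ≤ S.marginal n (f x) x

/-- The oracle rate `ε_{n,0}`, the root of
`inf {ε_n(λ)² : λ ∈ Λ_n, ε_n(λ)² ≥ m_n (log n) / n} ∨ m_n (log n) / n`.  If the set is empty,
its infimum in Lean is `0`, so that `ε_{n,0}² = m_n (log n) / n`. -/
noncomputable def ε₀ (S : EBSetup Θ 𝒳 Λ) (n : ℕ) : ℝ :=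
  √(max (sInf {t : ℝ | ∃ l ∈ S.Λn n, S.m n * Real.log n / n ≤ S.ε n l ^ 2 ∧ t = S.ε n l ^ 2})
    (S.m n * Real.log n / n))

/-- The set `Λ_0 = {λ ∈ Λ_n : ε_n(λ) ≤ M_n ε_{n,0}}`. -/
def Λ₀ (S : EBSetup Θ 𝒳 Λ) (n : ℕ) : Set Λ :=
  {l | l ∈ S.Λn n ∧ S.ε n l ≤ S.M n * S.ε₀ n}

/-- The perturbed likelihood `q_{λ,n}^θ(x) = sup {p_{ψ_{λ,λ'}(θ)}^n(x) : ρ(λ,λ') ≤ u_n}`. -/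
noncomputable def q (S : EBSetup Θ 𝒳 Λ) (n : ℕ) (l : Λ) (θ : Θ) (x : 𝒳 n) : ℝ≥0∞ :=
  ⨆ l' ∈ S.Λn n, ⨆ _ : (S.ρ n l l' : ℝ) ≤ S.u n, (S.p n (S.ψ n l l' θ) x : ℝ≥0∞)

/-- The measure `Q_{λ,n}^θ` with density `q_{λ,n}^θ`. -/
noncomputable def Q (S : EBSetup Θ 𝒳 Λ) (n : ℕ) (l : Λ) (θ : Θ) : Measure (𝒳 n) :=
  (S.μ n).withDensity (S.q n l θ)

/-- The Kullback-Leibler divergence `K(θ₀, θ)` of `P_θ^n` from `P_{θ₀}^n`. -/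
noncomputable def KL (S : EBSetup Θ 𝒳 Λ) (n : ℕ) (θ : Θ) : ℝ≥0∞ :=
  InformationTheory.klDiv (S.P n S.θ₀) (S.P n θ)

/-- The centred second moment `V₂(θ₀, θ)` of the log-likelihood ratio (meaningful if the
Kullback-Leibler divergence is finite; it is used only then). -/
noncomputable def V₂ (S : EBSetup Θ 𝒳 Λ) (n : ℕ) (θ : Θ) : ℝ≥0∞ :=
  ∫⁻ x, ENNReal.ofReal
    (|Real.log (S.p n S.θ₀ x) - Real.log (S.p n θ x) - (S.KL n θ).toReal| ^ 2) ∂(S.P n S.θ₀)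

/-- The Kullback-Leibler neighbourhood `B(θ₀, e, 2)`. -/
def klNhd (S : EBSetup Θ 𝒳 Λ) (n : ℕ) (e : ℝ) : Set Θ :=
  {θ | S.KL n θ ≤ ENNReal.ofReal (n * e ^ 2) ∧ S.V₂ n θ ≤ ENNReal.ofReal (n * e ^ 2)}

/-- Prior balls around `θ₀` lie in Kullback-Leibler neighbourhoods, for hyper-parameters among
which one attains the oracle rate up to a constant. -/
def CondB1 (S : EBSetup Θ 𝒳 Λ) : Prop :=
  ∃ (L : ℕ → Set Λ) (M₁ M₂ : ℝ), 0 < M₁ ∧ 1 ≤ M₂ ∧ ∀ᶠ n : ℕ in atTop,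
    L n ⊆ S.Λ₀ n ∧
    (∀ l ∈ L n, {θ | ‖θ - S.θ₀‖ ≤ S.K * S.ε n l} ⊆ S.klNhd n (M₂ * S.ε n l)) ∧
    ∃ l ∈ L n, S.ε n l ≤ M₁ * S.ε₀ n

/-- The complements of the sieves `Θ_n(λ)`, given by `Θn`, have small mass under the perturbed
likelihood. -/
def CondC1 (S : EBSetup Θ 𝒳 Λ) (Θn : ℕ → Λ → Set Θ) (c₂ : ℝ) : Prop :=
  ∀ᶠ n : ℕ in atTop, ∀ l ∈ S.Λ₀ n, MeasurableSet (Θn n l) ∧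
    ∫⁻ θ in (Θn n l)ᶜ, S.Q n l θ Set.univ ∂(S.prior l)
      ≤ ENNReal.ofReal (Real.exp (-(c₂ * n * S.ε₀ n ^ 2)))

/-- Tests on the sieves `Θn`, and entropy bounds for all radii
`u ≥ M' M_n ε_{n,0}`.  A test is a measurable function of the observation with values in
`[0, 1]`. -/
def CondC2 (S : EBSetup Θ 𝒳 Λ) (Θn : ℕ → Λ → Set Θ) (c₁ ζ M' : ℝ) : Prop :=
  ∀ᶠ n : ℕ in atTop, ∀ l ∈ S.Λ₀ n,
    (∀ θ ∈ Θn n l, ∃ φ : 𝒳 n → ℝ≥0∞, Measurable φ ∧ (∀ x, φ x ≤ 1) ∧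
      ∫⁻ x, φ x ∂(S.P n S.θ₀) ≤ ENNReal.ofReal (Real.exp (-(c₁ * n * S.d θ S.θ₀ ^ 2))) ∧
      ∀ θ', S.d θ θ' ≤ ζ * S.d θ S.θ₀ →
        ∫⁻ x, (1 - φ x) ∂(S.Q n l θ')
          ≤ ENNReal.ofReal (Real.exp (-(c₁ * n * S.d θ S.θ₀ ^ 2)))) ∧
    ∀ u : ℝ, M' * S.M n * S.ε₀ n ≤ u →
      (coveringNumberOf S.d (ζ * u)
          ({θ | u ≤ S.d θ S.θ₀ ∧ S.d θ S.θ₀ ≤ 2 * u} ∩ Θn n l) : ℝ≥0∞)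
        ≤ ENNReal.ofReal (Real.exp (c₁ * n * u ^ 2 / 2))

/-- The changes of measure move the points of the sieves `Θn` at distance at most
`M' M_n ε_{n,0}` from `θ₀` by at most `C₀ M_n ε_{n,0}`. -/
def CondC3 (S : EBSetup Θ 𝒳 Λ) (Θn : ℕ → Λ → Set Θ) (M' C₀ : ℝ) : Prop :=
  ∀ᶠ n : ℕ in atTop, ∀ l ∈ S.Λ₀ n, ∀ θ ∈ Θn n l, S.d S.θ₀ θ ≤ M' * S.M n * S.ε₀ n →
    ∀ l' ∈ S.Λn n, (S.ρ n l l' : ℝ) ≤ S.u n →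
      S.d θ (S.ψ n l l' θ) ≤ C₀ * S.M n * S.ε₀ n

/-- The three conditions on sieves together.  The sieves may depend on `c₂`, and so may the
constants in the tests, the entropy bounds and the bound on the changes of measure. -/
def CondC (S : EBSetup Θ 𝒳 Λ) : Prop :=
  ∀ c₂ : ℝ, 0 < c₂ → ∃ (Θn : ℕ → Λ → Set Θ) (c₁ ζ M' C₀ : ℝ),
    0 < c₁ ∧ c₁ < 1 ∧ 0 < ζ ∧ ζ < 1 ∧ 0 < M' ∧ 0 < C₀ ∧
    S.CondC1 Θn c₂ ∧ S.CondC2 Θn c₁ ζ M' ∧ S.CondC3 Θn M' C₀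

/-- `log N_n(Λ_0) = O(n ε_{n,0}²)`. -/
def CondEntropy (S : EBSetup Θ 𝒳 Λ) : Prop :=
  ∃ C : ℝ, ∀ᶠ n : ℕ in atTop,
    (coveringNumberOf (fun l l' => (S.ρ n l l' : ℝ)) (S.u n) (S.Λ₀ n) : ℝ≥0∞)
      ≤ ENNReal.ofReal (Real.exp (C * n * S.ε₀ n ^ 2))

end EBSetup

/-! Write t for n times the squared oracle rate. The argument bounds the denominator of the
posterior at one fixed hyper-parameter l₀, and the numerator by a union over a finite net.
Denominator: the estimator maximizes the marginal likelihood, so its marginal is at least that at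
l₀. By `exists_p_le_marginal` the true density is then at most exp(c t) times the marginal at the
estimator, outside an event of probability O(1/t). No uniformity over hyper-parameters is needed.
Numerator: an estimate in Λ₀ is within u_n of some point i of a net of size at most exp(C t).
Transporting the prior by ψ and bounding the density by q (`setLIntegral_p_le`) leaves an integral
against the fixed prior at i. By (C3) the preimage of the far set lies in the complement of the
sieve together with the points at distance at least u = M' M_n ε₀ from θ₀. The first piece is small
by (C1), the second by tests glued over dyadic shells (`exists_test_of_shells`).
`lintegral_posterior_le` combines these bounds. With c₂ = c + C + 1 the factors exp(c t) and exp(C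
t) are absorbed and exp(-t) remains, which vanishes because t ≥ m_n log n. -/

/-! ### Covers, integrated likelihoods and unions of tests. -/

/-- A finite bound on the covering number is witnessed by a finite cover. -/
theorem exists_finset_cover_of_coveringNumberOf_le {α : Type*} {D : α → α → ℝ} {r : ℝ} {A : Set α}
    {b : ℝ} (h : (coveringNumberOf D r A : ℝ≥0∞) ≤ ENNReal.ofReal b) :
    ∃ T : Finset α, (∀ t ∈ T, t ∈ A) ∧ (∀ a ∈ A, ∃ t ∈ T, D t a ≤ r) ∧
      (T.card : ℝ≥0∞) ≤ ENNReal.ofReal b := by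
  have hne : coveringNumberOf D r A ≠ ⊤ := by
    intro h0
    rw [h0] at h
    simp at h
  -- The infimum is taken in ℕ∞: a cover of size below N + 1 has size at most N when N is finite.
  have hlt : coveringNumberOf D r A < coveringNumberOf D r A + 1 :=
    (ENat.lt_add_one_iff hne).2 le_rfl
  conv_lhs at hlt => unfold coveringNumberOf
  simp only [iInf_lt_iff] at hlt
  obtain ⟨T, hTA, hcov, hT⟩ := hlt
  have hT' : T.encard ≤ coveringNumberOf D r A := (ENat.lt_add_one_iff hne).1 hT
  have hfin : T.Finite := Set.encard_lt_top_iff.1 (hT'.trans_lt hne.lt_top)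
  refine ⟨hfin.toFinset, fun t ht => hTA (hfin.mem_toFinset.1 ht), fun a ha => ?_, ?_⟩
  · obtain ⟨t, ht, hta⟩ := hcov a ha
    exact ⟨t, hfin.mem_toFinset.2 ht, hta⟩
  · rw [hfin.encard_eq_coe_toFinset_card] at hT'
    have := ENat.toENNReal_le.2 hT'
    simpa using this.trans h

/-- If the likelihood ratio is at least `c` with high probability, for each parameter in `A`, then
the integrated likelihood over `A` is at least `π A / 2 * c` times the true likelihood, with high
probability. -/
theorem exists_lintegral_likelihood_ge {Θ X : Type*} [MeasurableSpace Θ] [MeasurableSpace X]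
    {P : Measure X} [SFinite P] {π : Measure Θ} [IsFiniteMeasure π] {p : Θ → X → ℝ≥0∞}
    (hp : Measurable (Function.uncurry p)) {f : X → ℝ≥0∞} (hf : Measurable f) {A : Set Θ}
    {c δ : ℝ≥0∞} (h : ∀ θ ∈ A, P {x | p θ x < c * f x} ≤ δ) :
    ∃ E : Set X, MeasurableSet E ∧ P E ≤ 2 * δ ∧
      ∀ x ∉ E, π A / 2 * (c * f x) ≤ ∫⁻ θ, p θ x ∂π := by
  by_cases h0 : π A = 0
  · exact ⟨∅, MeasurableSet.empty, by simp, by simp [h0]⟩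
  have hAt : π A ≠ ⊤ := measure_ne_top _ _
  set F : Set (Θ × X) := {z | p z.1 z.2 < c * f z.2} with hF
  have hFm : MeasurableSet F := measurableSet_lt hp ((hf.comp measurable_snd).const_mul c)
  -- The prior mass of the parameters in A with too small a likelihood ratio. Its mean is at most δ
  -- π(A) by Tonelli, so Markov's inequality at level π(A)/2 costs the factor 2; otherwise at least
  -- half of A is good. Only F must be measurable, not A.
  set g : X → ℝ≥0∞ := fun x => (π.restrict A) ((fun θ => (θ, x)) ⁻¹' F) with hg
  have hgm : Measurable g := measurable_measure_prodMk_right hFm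
  have hgi : ∫⁻ x, g x ∂P ≤ δ * π A := by
    rw [hg, ← Measure.prod_apply_symm hFm, Measure.prod_apply hFm]
    calc ∫⁻ θ in A, P (Prod.mk θ ⁻¹' F) ∂π ≤ ∫⁻ _ in A, δ ∂π :=
          setLIntegral_mono measurable_const fun θ hθ => h θ hθ
      _ = δ * π A := by simp
  have h2 : π A / 2 ≠ 0 := by simp [h0]
  have h2t : π A / 2 ≠ ⊤ := ENNReal.div_ne_top hAt (by simp)
  refine ⟨{x | π A / 2 ≤ g x}, measurableSet_le measurable_const hgm, ?_, fun x hx => ?_⟩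
  · refine (meas_ge_le_lintegral_div hgm.aemeasurable h2 h2t).trans ?_
    refine (ENNReal.div_le_div_right hgi _).trans ?_
    rw [ENNReal.div_le_iff h2 h2t, mul_comm 2 δ, mul_assoc, ENNReal.mul_div_cancel (by simp) (by simp)]
  · have hx' : g x < π A / 2 := not_le.1 hx
    set G : Set Θ := (fun θ => (θ, x)) ⁻¹' F with hG
    have hGm : MeasurableSet G := measurable_prodMk_right hFm
    have hsplit : g x + π (A \ G) = π A := by
      simp only [hg]
      rw [Measure.restrict_apply hGm, Set.inter_comm]
      exact measure_inter_add_sdiff A hGm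
    have hge : π A / 2 ≤ π (A \ G) := by
      by_contra hlt
      have := ENNReal.add_lt_add hx' (not_le.1 hlt)
      rw [hsplit, ENNReal.add_halves] at this
      exact lt_irrefl _ this
    calc π A / 2 * (c * f x) ≤ π (A \ G) * (c * f x) := by gcongr
      _ = ∫⁻ _ in A \ G, c * f x ∂π := by rw [setLIntegral_const, mul_comm]
      _ ≤ ∫⁻ θ in A \ G, p θ x ∂π := by
          refine setLIntegral_mono (hp.comp measurable_prodMk_right) fun θ hθ => ?_
          exact not_lt.1 hθ.2
      _ ≤ ∫⁻ θ, p θ x ∂π := setLIntegral_le_lintegral _ _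

/-- A union bound: finitely many tests are dominated by one test whose error of the first kind is
at most the sum of theirs; here for a countable family of finite families. -/
theorem exists_test_ge {X ι : Type*} [MeasurableSpace X] {P : Measure X} (T : ℕ → Finset ι)
    (φ : ι → X → ℝ≥0∞) (hφ : ∀ j, ∀ t ∈ T j, Measurable (φ t))
    (hφ1 : ∀ j, ∀ t ∈ T j, ∀ x, φ t x ≤ 1) :
    ∃ Φ : X → ℝ≥0∞, Measurable Φ ∧ (∀ x, Φ x ≤ 1) ∧
      ∫⁻ x, Φ x ∂P ≤ ∑' j, ∑ t ∈ T j, ∫⁻ x, φ t x ∂P ∧ ∀ j, ∀ t ∈ T j, ∀ x, φ t x ≤ Φ x := by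
  have hm : ∀ j, Measurable fun x => ∑ t ∈ T j, φ t x := fun j =>
    Finset.measurable_fun_sum _ fun t ht => hφ j t ht
  refine ⟨fun x => min 1 (∑' j, ∑ t ∈ T j, φ t x), measurable_const.min (Measurable.tsum hm),
    fun x => min_le_left _ _, ?_, fun j t ht x => le_min (hφ1 j t ht x) ?_⟩
  · calc _ ≤ ∫⁻ x, ∑' j, ∑ t ∈ T j, φ t x ∂P := lintegral_mono fun x => min_le_right _ _
      _ = ∑' j, ∫⁻ x, ∑ t ∈ T j, φ t x ∂P := lintegral_tsum fun j => (hm j).aemeasurable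
      _ = _ := by
          congr 1
          ext j
          exact lintegral_finsetSum' _ fun t ht => (hφ j t ht).aemeasurable
  · exact (Finset.single_le_sum (f := fun t => φ t x) (fun _ _ => zero_le) ht).trans
      (ENNReal.le_tsum (f := fun j => ∑ t ∈ T j, φ t x) j)

/-! ### Densities and likelihood ratios. -/

namespace EBSetup

variable {Θ : Type*} [NormedAddCommGroup Θ] [MeasurableSpace Θ]
  {𝒳 : ℕ → Type*} [∀ n, MeasurableSpace (𝒳 n)]
  {k : ℕ} {Λ : Set (EuclideanSpace ℝ (Fin k))}

attribute [instance] EBSetup.sigmaFinite_μ EBSetup.isMarkov_prior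

theorem measurable_p_coe (S : EBSetup Θ 𝒳 Λ) (n : ℕ) :
    Measurable (Function.uncurry fun θ x => (S.p n θ x : ℝ≥0∞)) :=
  (S.measurable_p n).coe_nnreal_ennreal

theorem measurable_p_right (S : EBSetup Θ 𝒳 Λ) (n : ℕ) (θ : Θ) : Measurable (S.p n θ) :=
  (S.measurable_p n).comp measurable_prodMk_left

instance isProbabilityMeasure_P (S : EBSetup Θ 𝒳 Λ) (n : ℕ) (θ : Θ) :
    IsProbabilityMeasure (S.P n θ) :=
  ⟨by simp [P, S.lintegral_p]⟩

theorem ae_p_pos (S : EBSetup Θ 𝒳 Λ) (n : ℕ) (θ : Θ) : ∀ᵐ x ∂(S.P n θ), 0 < S.p n θ x := by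
  rw [P, ae_withDensity_iff (S.measurable_p_right n θ).coe_nnreal_ennreal]
  refine Eventually.of_forall fun x hx => ?_
  exact pos_iff_ne_zero.2 (by simpa using hx)

/-- Finiteness of the density makes measurability of `g` unnecessary. This matters for the posterior
at the estimator, whose measurability in x is not established. -/
theorem lintegral_P (S : EBSetup Θ 𝒳 Λ) (n : ℕ) (θ : Θ) (g : 𝒳 n → ℝ≥0∞) :
    ∫⁻ x, g x ∂(S.P n θ) = ∫⁻ x, S.p n θ x * g x ∂(S.μ n) := by
  rw [P, lintegral_withDensity_eq_lintegral_mul_non_measurable _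
    (S.measurable_p_right n θ).coe_nnreal_ennreal (by simp)]
  rfl

theorem klNhd_mono (S : EBSetup Θ 𝒳 Λ) (n : ℕ) {a b : ℝ} (ha : 0 ≤ a) (hab : a ≤ b) :
    S.klNhd n a ⊆ S.klNhd n b := by
  intro θ hθ
  have : ENNReal.ofReal (n * a ^ 2) ≤ ENNReal.ofReal (n * b ^ 2) := by gcongr
  exact ⟨hθ.1.trans this, hθ.2.trans this⟩

/-- Chebyshev's inequality for the log-likelihood ratio in a Kullback-Leibler neighbourhood. -/
theorem measure_p_lt_le (S : EBSetup Θ 𝒳 Λ) (n : ℕ) {e : ℝ} {θ : Θ} (hθ : θ ∈ S.klNhd n e)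
    (ht : 0 < n * e ^ 2) :
    S.P n S.θ₀ {x | (S.p n θ x : ℝ≥0∞) <
      ENNReal.ofReal (Real.exp (-(2 * (n * e ^ 2)))) * S.p n S.θ₀ x} ≤
      ENNReal.ofReal (n * e ^ 2)⁻¹ := by
  set t : ℝ := n * e ^ 2 with ht_def
  obtain ⟨hK, hV⟩ := hθ
  have hKt : S.KL n θ ≠ ⊤ := ne_top_of_le_ne_top ENNReal.ofReal_ne_top hK
  -- Finite divergence gives absolute continuity, so both densities are positive almost surely under
  -- the truth and the convention log 0 = 0 does no harm.
  have hac : S.P n S.θ₀ ≪ S.P n θ := (InformationTheory.klDiv_ne_top_iff.1 hKt).1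
  have hKr : (S.KL n θ).toReal ≤ t := ENNReal.toReal_le_of_le_ofReal ht.le hK
  set g : 𝒳 n → ℝ≥0∞ := fun x => ENNReal.ofReal
    (|Real.log (S.p n S.θ₀ x) - Real.log (S.p n θ x) - (S.KL n θ).toReal| ^ 2) with hg
  have hgm : Measurable g := by
    have h1 := S.measurable_p_right n θ
    have h2 := S.measurable_p_right n S.θ₀
    fun_prop
  have hsub : {x | (S.p n θ x : ℝ≥0∞) < ENNReal.ofReal (Real.exp (-(2 * t))) * S.p n S.θ₀ x}
      ≤ᵐ[S.P n S.θ₀] {x | ENNReal.ofReal (t ^ 2) ≤ g x} := by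
    filter_upwards [S.ae_p_pos n S.θ₀, hac.ae_le (S.ae_p_pos n θ)] with x h0 h1 hx
    have h0' : (0 : ℝ) < S.p n S.θ₀ x := by exact_mod_cast h0
    have h1' : (0 : ℝ) < S.p n θ x := by exact_mod_cast h1
    have hx' : (S.p n θ x : ℝ) < Real.exp (-(2 * t)) * S.p n S.θ₀ x := by
      have hx2 : (S.p n θ x : ℝ≥0∞) < ENNReal.ofReal (Real.exp (-(2 * t))) * S.p n S.θ₀ x := hx
      rw [← ENNReal.ofReal_coe_nnreal, ← ENNReal.ofReal_coe_nnreal (p := S.p n S.θ₀ x),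
        ← ENNReal.ofReal_mul (Real.exp_pos _).le] at hx2
      exact (ENNReal.ofReal_lt_ofReal_iff (by positivity)).1 hx2
    have hlog := Real.log_lt_log h1' hx'
    rw [Real.log_mul (Real.exp_pos _).ne' h0'.ne', Real.log_exp] at hlog
    -- The log ratio exceeds 2t and its centring is at most t, so the deviation is at least t.
    refine ENNReal.ofReal_le_ofReal (pow_le_pow_left₀ ht.le (le_trans ?_ (le_abs_self _)) 2)
    linarith
  calc _ ≤ S.P n S.θ₀ {x | ENNReal.ofReal (t ^ 2) ≤ g x} := measure_mono_ae hsub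
    _ ≤ (∫⁻ x, g x ∂(S.P n S.θ₀)) / ENNReal.ofReal (t ^ 2) :=
        meas_ge_le_lintegral_div hgm.aemeasurable (by simp; positivity) ENNReal.ofReal_ne_top
    _ ≤ ENNReal.ofReal t / ENNReal.ofReal (t ^ 2) := ENNReal.div_le_div_right hV _
    _ = ENNReal.ofReal t⁻¹ := by
        rw [← ENNReal.ofReal_div_of_pos (by positivity)]
        congr 1
        field_simp

/-! ### Gluing tests over dyadic shells. -/

/-- Tests for the points of a sieve that are at distance at least `u` from `θ₀`, by gluing the
tests on the shells of radii `2 ^ j * u`. -/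
theorem exists_test_of_shells (S : EBSetup Θ 𝒳 Λ) (n : ℕ) (l : Λ) {A : Set Θ} {c ζ u : ℝ}
    (hc : 0 < c) (hζ : 0 < ζ) (hu : 0 < u)
    (htest : ∀ θ ∈ A, ∃ φ : 𝒳 n → ℝ≥0∞, Measurable φ ∧ (∀ x, φ x ≤ 1) ∧
      ∫⁻ x, φ x ∂(S.P n S.θ₀) ≤ ENNReal.ofReal (Real.exp (-(c * n * S.d θ S.θ₀ ^ 2))) ∧
      ∀ θ', S.d θ θ' ≤ ζ * S.d θ S.θ₀ →
        ∫⁻ x, (1 - φ x) ∂(S.Q n l θ')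
          ≤ ENNReal.ofReal (Real.exp (-(c * n * S.d θ S.θ₀ ^ 2))))
    (hcov : ∀ v : ℝ, u ≤ v → (coveringNumberOf S.d (ζ * v)
          ({θ | v ≤ S.d θ S.θ₀ ∧ S.d θ S.θ₀ ≤ 2 * v} ∩ A) : ℝ≥0∞)
        ≤ ENNReal.ofReal (Real.exp (c * n * v ^ 2 / 2))) :
    ∃ φ : 𝒳 n → ℝ≥0∞, Measurable φ ∧ (∀ x, φ x ≤ 1) ∧
      ∫⁻ x, φ x ∂(S.P n S.θ₀) ≤ ENNReal.ofReal (Real.exp (-(c * n * u ^ 2 / 2))) *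
        (1 - ENNReal.ofReal (Real.exp (-(c * n * u ^ 2 / 2))))⁻¹ ∧
      ∀ θ ∈ A, u ≤ S.d θ S.θ₀ →
        ∫⁻ x, (1 - φ x) ∂(S.Q n l θ) ≤ ENNReal.ofReal (Real.exp (-(c * n * u ^ 2 / 2))) := by
  choose! φ hφm hφ1 hφI hφII using htest
  have hv : ∀ j : ℕ, u ≤ 2 ^ j * u := fun j =>
    le_mul_of_one_le_left hu.le (one_le_pow₀ (by norm_num))
  choose T hTA hTcov hTcard using fun j : ℕ =>
    exists_finset_cover_of_coveringNumberOf_le (hcov (2 ^ j * u) (hv j))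
  obtain ⟨Φ, hΦm, hΦ1, hΦI, hΦge⟩ := exists_test_ge (P := S.P n S.θ₀) T φ
    (fun j t ht => hφm t (hTA j t ht).2) (fun j t ht => hφ1 t (hTA j t ht).2)
  refine ⟨Φ, hΦm, hΦ1, hΦI.trans ?_, fun θ hθ hd => ?_⟩
  · set r := Real.exp (-(c * n * u ^ 2 / 2)) with hr
    -- In `ℝ≥0∞` the geometric series needs no r < 1; for r = 1 the bound is ⊤. Entropy costs half
    -- the testing exponent, so shell j contributes at most r ^ (j + 1), because j + 1 ≤ 4 ^ j.
    rw [← ENNReal.tsum_geometric, ← ENNReal.tsum_mul_left]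
    refine ENNReal.tsum_le_tsum fun j => ?_
    set v : ℝ := 2 ^ j * u with hv_def
    have hv0 : 0 < v := hu.trans_le (hv j)
    calc ∑ t ∈ T j, ∫⁻ x, φ t x ∂(S.P n S.θ₀)
        ≤ ∑ t ∈ T j, ENNReal.ofReal (Real.exp (-(c * n * v ^ 2))) := by
          refine Finset.sum_le_sum fun t ht => (hφI t (hTA j t ht).2).trans ?_
          have := (hTA j t ht).1.1
          gcongr
      _ = (T j).card * ENNReal.ofReal (Real.exp (-(c * n * v ^ 2))) := by simp
      _ ≤ ENNReal.ofReal (Real.exp (c * n * v ^ 2 / 2)) *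
            ENNReal.ofReal (Real.exp (-(c * n * v ^ 2))) := by gcongr; exact hTcard j
      _ = ENNReal.ofReal (Real.exp (-(c * n * v ^ 2 / 2))) := by
          rw [← ENNReal.ofReal_mul (Real.exp_pos _).le, ← Real.exp_add]
          congr 2
          ring
      _ ≤ ENNReal.ofReal (r * r ^ j) := by
          refine ENNReal.ofReal_le_ofReal ?_
          rw [← pow_succ', hr, ← Real.exp_nat_mul]
          refine Real.exp_le_exp.2 ?_
          have h1 : ((j + 1 : ℕ) : ℝ) ≤ 4 ^ j := by
            exact_mod_cast (Nat.lt_pow_self (n := j) (a := 4) (by norm_num))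
          have h2 : v ^ 2 = 4 ^ j * u ^ 2 := by
            rw [hv_def, mul_pow, ← pow_mul, mul_comm j 2, pow_mul]
            norm_num
          have h3 := mul_le_mul_of_nonneg_right h1 (show 0 ≤ c * n * u ^ 2 / 2 by positivity)
          rw [h2]
          linarith
      _ = ENNReal.ofReal r * ENNReal.ofReal r ^ j := by
          rw [ENNReal.ofReal_mul (Real.exp_pos _).le, ENNReal.ofReal_pow (Real.exp_pos _).le]
  · obtain ⟨j, hj1, hj2⟩ := exists_nat_pow_near (x := S.d θ S.θ₀ / u) (y := 2)
      ((one_le_div hu).2 hd) (by norm_num)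
    rw [le_div_iff₀ hu] at hj1
    rw [div_lt_iff₀ hu, pow_succ'] at hj2
    -- The centre t lies in the same shell, so the covering radius ζ 2 ^ j u is at most ζ d(t, θ₀),
    -- and the single test at t already controls θ.
    obtain ⟨t, ht, htθ⟩ := hTcov j θ ⟨⟨hj1, by linarith⟩, hθ⟩
    have htd := (hTA j t ht).1.1
    have hut : u ≤ S.d t S.θ₀ := (hv j).trans htd
    calc ∫⁻ x, (1 - Φ x) ∂(S.Q n l θ) ≤ ∫⁻ x, (1 - φ t x) ∂(S.Q n l θ) :=
          lintegral_mono fun x => tsub_le_tsub_left (hΦge j t ht x) 1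
      _ ≤ ENNReal.ofReal (Real.exp (-(c * n * S.d t S.θ₀ ^ 2))) :=
          hφII t (hTA j t ht).2 θ (htθ.trans (by gcongr))
      _ ≤ _ := by
          refine ENNReal.ofReal_le_ofReal (Real.exp_le_exp.2 (neg_le_neg ?_))
          have h1 : c * n * u ^ 2 ≤ c * n * S.d t S.θ₀ ^ 2 := by gcongr
          have h2 : 0 ≤ c * n * u ^ 2 := by positivity
          linarith

/-! ### Perturbed likelihoods and the posterior bound. -/

theorem measurable_q (S : EBSetup Θ 𝒳 Λ) {n : ℕ} {l : Λ} (hl : l ∈ S.Λn n) :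
    Measurable (Function.uncurry (S.q n l)) :=
  S.measurable_sup n l hl

theorem lintegral_Q (S : EBSetup Θ 𝒳 Λ) {n : ℕ} {l : Λ} (hl : l ∈ S.Λn n) (θ : Θ)
    {g : 𝒳 n → ℝ≥0∞} (hg : Measurable g) :
    ∫⁻ x, g x ∂(S.Q n l θ) = ∫⁻ x, g x * S.q n l θ x ∂(S.μ n) := by
  have hq : Measurable (S.q n l θ) := (S.measurable_q hl).of_uncurry_left
  rw [Q, lintegral_withDensity_eq_lintegral_mul _ hq hg]
  simp only [Pi.mul_apply, mul_comm]

theorem posterior_le_one (S : EBSetup Θ 𝒳 Λ) (n : ℕ) (l : Λ) (x : 𝒳 n) (B : Set Θ) :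
    S.posterior n l x B ≤ 1 :=
  (ENNReal.div_le_div_right (setLIntegral_le_lintegral _ _) _).trans ENNReal.div_self_le_one

/-- A pointwise evidence bound cancels the denominator. `ENNReal.mul_div_le` also covers marginals
equal to 0 or ⊤. -/
theorem p_mul_posterior_le (S : EBSetup Θ 𝒳 Λ) {n : ℕ} {l : Λ} {x : 𝒳 n} (B : Set Θ) {a : ℝ≥0∞}
    (h : (S.p n S.θ₀ x : ℝ≥0∞) ≤ a * S.marginal n l x) :
    S.p n S.θ₀ x * S.posterior n l x B ≤ a * ∫⁻ θ in B, S.p n θ x ∂(S.prior l) := by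
  calc _ ≤ a * S.marginal n l x * S.posterior n l x B := by gcongr
    _ = a * (S.marginal n l x * S.posterior n l x B) := mul_assoc _ _ _
    _ ≤ _ := by
      gcongr
      exact ENNReal.mul_div_le

/-- The numerator of the posterior at `l'` is at most an integral of the perturbed likelihood
at a nearby `l`. -/
theorem setLIntegral_p_le (S : EBSetup Θ 𝒳 Λ) {n : ℕ} {l l' : Λ} (hl : l ∈ S.Λn n)
    (hl' : l' ∈ S.Λn n) (hρ : (S.ρ n l l' : ℝ) ≤ S.u n) {B : Set Θ} (hB : MeasurableSet B)
    (x : 𝒳 n) :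
    ∫⁻ θ in B, S.p n θ x ∂(S.prior l') ≤
      ∫⁻ θ in S.ψ n l l' ⁻¹' B, S.q n l θ x ∂(S.prior l) := by
  have hp : Measurable fun θ => (S.p n θ x : ℝ≥0∞) :=
    (S.measurable_p_coe n).of_uncurry_right
  rw [← (S.measurePreserving_ψ n l hl l' hl').setLIntegral_comp_preimage hB hp]
  refine lintegral_mono fun θ => ?_
  exact le_iSup₂_of_le l' hl' (le_iSup_of_le (f := fun _ : (S.ρ n l l' : ℝ) ≤ S.u n =>
    (S.p n (S.ψ n l l' θ) x : ℝ≥0∞)) hρ le_rfl)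

/-- The integrated error of the second kind of a test for the part of the prior outside the
sieve `A` or at distance at least `u` from `θ₀`. -/
theorem lintegral_one_sub_mul_setLIntegral_q_le (S : EBSetup Θ 𝒳 Λ) {n : ℕ} {l : Λ}
    (hl : l ∈ S.Λn n) {A : Set Θ} {u : ℝ} {φ : 𝒳 n → ℝ≥0∞}
    (hφ : Measurable φ) {β γ : ℝ≥0∞} (hβ : ∫⁻ θ in Aᶜ, S.Q n l θ Set.univ ∂(S.prior l) ≤ β)
    (hγ : ∀ θ ∈ A, u ≤ S.d θ S.θ₀ → ∫⁻ x, (1 - φ x) ∂(S.Q n l θ) ≤ γ) :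
    ∫⁻ x, (1 - φ x) * ∫⁻ θ in Aᶜ ∪ {θ | u ≤ S.d θ S.θ₀}, S.q n l θ x ∂(S.prior l) ∂(S.μ n)
      ≤ β + γ := by
  have hqm := S.measurable_q hl
  have h1φ : Measurable fun x => 1 - φ x := measurable_const.sub hφ
  set D : Set Θ := {θ | u ≤ S.d θ S.θ₀}
  set F : Θ → ℝ≥0∞ := fun θ => ∫⁻ x, (1 - φ x) ∂(S.Q n l θ) with hF
  have hswap : ∫⁻ x, (1 - φ x) * ∫⁻ θ in Aᶜ ∪ D, S.q n l θ x ∂(S.prior l) ∂(S.μ n)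
      = ∫⁻ θ in Aᶜ ∪ D, F θ ∂(S.prior l) := by
    have hm : Measurable (Function.uncurry fun θ x => (1 - φ x) * S.q n l θ x) :=
      (h1φ.comp measurable_snd).mul hqm
    simp only [hF]
    simp_rw [S.lintegral_Q hl _ h1φ]
    rw [lintegral_lintegral_swap hm.aemeasurable]
    refine lintegral_congr fun x => ?_
    have hqx : Measurable fun θ => S.q n l θ x := hqm.of_uncurry_right
    rw [lintegral_const_mul _ hqx]
  rw [hswap]
  -- The test controls only points of the sieve; off it, the total mass of Q is used.
  calc ∫⁻ θ in Aᶜ ∪ D, F θ ∂(S.prior l) ≤ ∫⁻ θ in Aᶜ ∪ (A ∩ D), F θ ∂(S.prior l) := by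
        refine lintegral_mono_set fun θ hθ => ?_
        by_cases hθA : θ ∈ A
        · exact Or.inr ⟨hθA, hθ.resolve_left fun h => h hθA⟩
        · exact Or.inl hθA
    _ ≤ ∫⁻ θ in Aᶜ, F θ ∂(S.prior l) + ∫⁻ θ in A ∩ D, F θ ∂(S.prior l) :=
        lintegral_union_le _ _ _
    _ ≤ ∫⁻ θ in Aᶜ, S.Q n l θ Set.univ ∂(S.prior l) + ∫⁻ _ in A ∩ D, γ ∂(S.prior l) := by
        refine add_le_add (lintegral_mono fun θ => ?_)
          (setLIntegral_mono measurable_const fun θ hθ => hγ θ hθ.1 hθ.2)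
        calc F θ ≤ ∫⁻ _, 1 ∂(S.Q n l θ) := lintegral_mono fun x => tsub_le_self
          _ = _ := by simp
    _ ≤ β + γ := by
        refine add_le_add hβ ?_
        rw [setLIntegral_const]
        exact mul_le_of_le_one_right' prob_le_one

/-- A non-asymptotic bound on the expected posterior mass of a set `B`. -/
theorem lintegral_posterior_le (S : EBSetup Θ 𝒳 Λ) {n : ℕ} {f : 𝒳 n → Λ} (hf : S.IsMMLE n f)
    {B : Set Θ} (hB : MeasurableSet B) {E : Set (𝒳 n)} (hE : MeasurableSet E) {l₀ : Λ}
    (hl₀ : l₀ ∈ S.Λn n) {a : ℝ≥0∞} (hEa : ∀ x ∉ E, (S.p n S.θ₀ x : ℝ≥0∞) ≤ a * S.marginal n l₀ x)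
    {I : Finset Λ} (hI : ∀ i ∈ I, i ∈ S.Λn n)
    (hcov : ∀ l ∈ S.Λ₀ n, ∃ i ∈ I, (S.ρ n i l : ℝ) ≤ S.u n) {A : Λ → Set Θ} {u : ℝ}
    (hBA : ∀ i ∈ I, ∀ l ∈ S.Λ₀ n, (S.ρ n i l : ℝ) ≤ S.u n →
      S.ψ n i l ⁻¹' B ⊆ (A i)ᶜ ∪ {θ | u ≤ S.d θ S.θ₀})
    {φ : Λ → 𝒳 n → ℝ≥0∞} (hφ : ∀ i ∈ I, Measurable (φ i)) (hφ1 : ∀ i ∈ I, ∀ x, φ i x ≤ 1)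
    {τ β γ : ℝ≥0∞} (hτ : ∀ i ∈ I, ∫⁻ x, φ i x ∂(S.P n S.θ₀) ≤ τ)
    (hβ : ∀ i ∈ I, ∫⁻ θ in (A i)ᶜ, S.Q n i θ Set.univ ∂(S.prior i) ≤ β)
    (hγ : ∀ i ∈ I, ∀ θ ∈ A i, u ≤ S.d θ S.θ₀ → ∫⁻ x, (1 - φ i x) ∂(S.Q n i θ) ≤ γ) :
    ∫⁻ x, S.posterior n (f x) x B ∂(S.P n S.θ₀) ≤
      S.P n S.θ₀ {x | f x ∉ S.Λ₀ n} + (S.P n S.θ₀ E + (I.card * τ + a * (I.card * (β + γ)))) := by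
  set G : Set (𝒳 n) := {x | f x ∉ S.Λ₀ n} with hG
  set p₀ : 𝒳 n → ℝ≥0∞ := fun x => S.p n S.θ₀ x with hp₀
  have hp₀m : Measurable p₀ := (S.measurable_p_right n S.θ₀).coe_nnreal_ennreal
  set H : Λ → 𝒳 n → ℝ≥0∞ := fun i x =>
    (1 - φ i x) * ∫⁻ θ in (A i)ᶜ ∪ {θ | u ≤ S.d θ S.θ₀}, S.q n i θ x ∂(S.prior i) with hH
  have hHm : ∀ i ∈ I, Measurable (H i) := fun i hi =>
    (measurable_const.sub (hφ i hi)).mul (S.measurable_q (hI i hi)).lintegral_prod_left'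
  have hpt : ∀ x, p₀ x * S.posterior n (f x) x B ≤ p₀ x * G.indicator (fun _ => 1) x +
      (p₀ x * E.indicator (fun _ => 1) x + (p₀ x * ∑ i ∈ I, φ i x + a * ∑ i ∈ I, H i x)) := by
    intro x
    have h1 : p₀ x * S.posterior n (f x) x B ≤ p₀ x * 1 := by
      gcongr
      exact S.posterior_le_one _ _ _ _
    by_cases hxG : x ∈ G
    · rw [Set.indicator_of_mem hxG]
      exact h1.trans le_self_add
    by_cases hxE : x ∈ E
    · rw [Set.indicator_of_mem hxE]
      exact h1.trans (le_self_add.trans le_add_self)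
    have hxΛ : f x ∈ S.Λ₀ n := not_not.1 hxG
    obtain ⟨i, hi, hρ⟩ := hcov (f x) hxΛ
    refine le_trans ?_ (le_add_self.trans le_add_self)
    have hpm : p₀ x ≤ a * S.marginal n (f x) x :=
      -- Maximality of the marginal likelihood moves the evidence bound from l₀ to the
      -- data-dependent hyper-parameter.
      (hEa x hxE).trans (by gcongr; exact (hf x).2 l₀ hl₀)
    have hnum := (S.p_mul_posterior_le B hpm).trans (mul_le_mul_right
      ((S.setLIntegral_p_le (hI i hi) hxΛ.1 hρ hB x).trans
        (lintegral_mono_set (hBA i hi (f x) hxΛ hρ))) a)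
    calc p₀ x * S.posterior n (f x) x B
        = φ i x * (p₀ x * S.posterior n (f x) x B)
          + (1 - φ i x) * (p₀ x * S.posterior n (f x) x B) := by
          rw [← add_mul, add_tsub_cancel_of_le (hφ1 i hi x), one_mul]
      _ ≤ φ i x * (p₀ x * 1) + (1 - φ i x) * (a * _) :=
          add_le_add (mul_le_mul_right h1 _) (mul_le_mul_right hnum _)
      _ = p₀ x * φ i x + a * H i x := by
          simp only [hH]
          ring
      _ ≤ p₀ x * ∑ i ∈ I, φ i x + a * ∑ i ∈ I, H i x := by
          gcongr
          · exact Finset.single_le_sum (f := fun i => φ i x) (fun _ _ => zero_le) hi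
          · exact Finset.single_le_sum (f := fun i => H i x) (fun _ _ => zero_le) hi
  rw [S.lintegral_P]
  have hφs : Measurable fun x => p₀ x * ∑ i ∈ I, φ i x :=
    hp₀m.mul (Finset.measurable_fun_sum _ hφ)
  have hHs : Measurable fun x => a * ∑ i ∈ I, H i x :=
    (Finset.measurable_fun_sum _ hHm).const_mul a
  have hEs : Measurable fun x => p₀ x * E.indicator (fun _ => (1 : ℝ≥0∞)) x :=
    hp₀m.mul (measurable_const.indicator hE)
  have hs₁ : Measurable fun x => p₀ x * ∑ i ∈ I, φ i x + a * ∑ i ∈ I, H i x := hφs.add hHs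
  have hs₂ : Measurable fun x => p₀ x * E.indicator (fun _ => 1) x +
      (p₀ x * ∑ i ∈ I, φ i x + a * ∑ i ∈ I, H i x) := hEs.add hs₁
  refine (lintegral_mono hpt).trans ?_
  -- The indicator of G stands on the left of the sum since only the right summand must be
  -- measurable.
  rw [lintegral_add_right _ hs₂, lintegral_add_right _ hs₁,
    lintegral_add_right _ hHs]
  refine add_le_add ?_ (add_le_add ?_ (add_le_add ?_ ?_))
  · rw [← S.lintegral_P]
    simpa using lintegral_indicator_const_le (μ := S.P n S.θ₀) G 1
  · rw [← S.lintegral_P]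
    simpa using lintegral_indicator_const_le (μ := S.P n S.θ₀) E 1
  · rw [← S.lintegral_P n S.θ₀ (fun x => ∑ i ∈ I, φ i x), lintegral_finsetSum' _
      fun i hi => (hφ i hi).aemeasurable]
    simpa using Finset.sum_le_card_nsmul I _ _ hτ
  · rw [lintegral_const_mul _ (Finset.measurable_fun_sum _ hHm), lintegral_finsetSum' _
      fun i hi => (hHm i hi).aemeasurable]
    gcongr
    rw [← nsmul_eq_mul]
    exact Finset.sum_le_card_nsmul I _ _ fun i hi =>
      S.lintegral_one_sub_mul_setLIntegral_q_le (hI i hi) (hφ i hi) (hβ i hi) (hγ i hi)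

/-! ### The oracle rate and the evidence bound. -/

theorem sq_ε₀ (S : EBSetup Θ 𝒳 Λ) {n : ℕ} (hm : 0 ≤ S.m n) :
    S.m n * Real.log n / n ≤ S.ε₀ n ^ 2 := by
  rw [ε₀, Real.sq_sqrt]
  · exact le_max_right _ _
  · exact le_max_of_le_right (by have := Real.log_natCast_nonneg n; positivity)

theorem tendsto_mul_sq_ε₀ (S : EBSetup Θ 𝒳 Λ) :
    Tendsto (fun n : ℕ => n * S.ε₀ n ^ 2) atTop atTop := by
  refine tendsto_atTop_mono' atTop ?_ (S.tendsto_m.atTop_mul_atTop₀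
    (Real.tendsto_log_atTop.comp tendsto_natCast_atTop_atTop))
  filter_upwards [S.tendsto_m.eventually_ge_atTop 0, eventually_gt_atTop 0] with n hm hn
  have hn' : (0 : ℝ) < n := by exact_mod_cast hn
  have := S.sq_ε₀ hm
  rw [div_le_iff₀ hn'] at this
  simp only [Function.comp]
  linarith

/-- The evidence lower bound: the marginal likelihood is at least `exp (-c n ε₀²)` times the true
likelihood with high probability, at a hyper-parameter whose rate is of the oracle order. -/
theorem exists_p_le_marginal [BorelSpace Θ] (S : EBSetup Θ 𝒳 Λ) {n : ℕ} {l : Λ} {M₁ M₂ : ℝ}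
    (hM₂ : 1 ≤ M₂) (hl : S.ε n l ≤ M₁ * S.ε₀ n)
    (hsub : {θ | ‖θ - S.θ₀‖ ≤ S.K * S.ε n l} ⊆ S.klNhd n (M₂ * S.ε n l))
    (hprior : Real.exp (-(S.c₀ * n * S.ε n l ^ 2)) ≤
      (S.prior l).real {θ | ‖θ - S.θ₀‖ ≤ S.K * S.ε n l})
    (ht : 1 ≤ n * S.ε₀ n ^ 2) (hM₁ : 0 < M₁) :
    ∃ E : Set (𝒳 n), MeasurableSet E ∧
      S.P n S.θ₀ E ≤ 2 * ENNReal.ofReal ((M₁ * M₂) ^ 2 * (n * S.ε₀ n ^ 2))⁻¹ ∧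
      ∀ x ∉ E, (S.p n S.θ₀ x : ℝ≥0∞) ≤ ENNReal.ofReal
        (Real.exp ((S.c₀ * M₁ ^ 2 + 2 * (M₁ * M₂) ^ 2 + 1) * (n * S.ε₀ n ^ 2))) *
          S.marginal n l x := by
  set t : ℝ := n * S.ε₀ n ^ 2 with ht_def
  -- The neighbourhood is enlarged to the oracle scale: the rate at l may be much smaller, even
  -- zero, and Chebyshev's bound 1/(n e²) must vanish.
  set e : ℝ := M₁ * M₂ * S.ε₀ n with he
  have hε := S.ε_nonneg n l
  have hc₀ := S.one_le_c₀
  have het : n * e ^ 2 = (M₁ * M₂) ^ 2 * t := by rw [he, ht_def]; ring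
  have hepos : 0 < n * e ^ 2 := by rw [het]; positivity
  have hsub' : {θ | ‖θ - S.θ₀‖ ≤ S.K * S.ε n l} ⊆ S.klNhd n e :=
    hsub.trans (S.klNhd_mono n (by positivity)
      (by rw [he]; nlinarith [mul_le_mul_of_nonneg_left hl (by linarith : (0 : ℝ) ≤ M₂)]))
  obtain ⟨E, hEm, hPE, hE⟩ := exists_lintegral_likelihood_ge (π := S.prior l) (S.measurable_p_coe n)
    (S.measurable_p_right n S.θ₀).coe_nnreal_ennreal
    fun θ hθ => S.measure_p_lt_le n (hsub' hθ) hepos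
  rw [het] at hPE hE
  refine ⟨E, hEm, hPE, fun x hx => ?_⟩
  -- The summands pay for the prior mass, the likelihood ratio and the factor 1/2, the last through
  -- exp(-1) ≤ 1/2 and t ≥ 1.
  set c : ℝ := S.c₀ * M₁ ^ 2 + 2 * (M₁ * M₂) ^ 2 + 1 with hc
  have hreal : Real.exp (-(c * t)) ≤
      Real.exp (-(S.c₀ * n * S.ε n l ^ 2)) / 2 * Real.exp (-(2 * ((M₁ * M₂) ^ 2 * t))) := by
    have h1 : S.c₀ * n * S.ε n l ^ 2 ≤ S.c₀ * M₁ ^ 2 * t := by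
      have : S.ε n l ^ 2 ≤ (M₁ * S.ε₀ n) ^ 2 := by gcongr
      calc S.c₀ * n * S.ε n l ^ 2 ≤ S.c₀ * n * (M₁ * S.ε₀ n) ^ 2 := by gcongr
        _ = _ := by rw [ht_def]; ring
    have h2 : Real.exp (-1) ≤ 1 / 2 := by
      rw [Real.exp_neg, inv_eq_one_div]
      exact one_div_le_one_div_of_le (by norm_num) (by linarith [Real.add_one_le_exp (1 : ℝ)])
    calc Real.exp (-(c * t)) ≤ Real.exp (-(S.c₀ * n * S.ε n l ^ 2) + -1 +
            -(2 * ((M₁ * M₂) ^ 2 * t))) := by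
          refine Real.exp_le_exp.2 ?_
          rw [hc]
          nlinarith
      _ = Real.exp (-(S.c₀ * n * S.ε n l ^ 2)) * Real.exp (-1) *
            Real.exp (-(2 * ((M₁ * M₂) ^ 2 * t))) := by rw [Real.exp_add, Real.exp_add]
      _ ≤ Real.exp (-(S.c₀ * n * S.ε n l ^ 2)) * (1 / 2) *
            Real.exp (-(2 * ((M₁ * M₂) ^ 2 * t))) := by gcongr
      _ = _ := by ring
  have hπ : ENNReal.ofReal (Real.exp (-(S.c₀ * n * S.ε n l ^ 2))) ≤
      S.prior l {θ | ‖θ - S.θ₀‖ ≤ S.K * S.ε n l} :=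
    ENNReal.ofReal_le_of_le_toReal hprior
  have hle : ENNReal.ofReal (Real.exp (-(c * t))) ≤
      S.prior l {θ | ‖θ - S.θ₀‖ ≤ S.K * S.ε n l} / 2 *
        ENNReal.ofReal (Real.exp (-(2 * ((M₁ * M₂) ^ 2 * t)))) := by
    refine (ENNReal.ofReal_le_ofReal hreal).trans ?_
    rw [ENNReal.ofReal_mul (by positivity), ENNReal.ofReal_div_of_pos (by norm_num),
      ENNReal.ofReal_ofNat]
    gcongr
  calc (S.p n S.θ₀ x : ℝ≥0∞)
      = ENNReal.ofReal (Real.exp (c * t)) *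
          (ENNReal.ofReal (Real.exp (-(c * t))) * S.p n S.θ₀ x) := by
        rw [← mul_assoc, ← ENNReal.ofReal_mul (Real.exp_pos _).le, ← Real.exp_add]
        simp
    _ ≤ ENNReal.ofReal (Real.exp (c * t)) * S.marginal n l x := by
        gcongr
        exact (mul_le_mul_left hle _).trans ((mul_assoc _ _ _).trans_le (hE x hx))

end EBSetup

/-! ### Contraction of the empirical Bayes posterior. -/

theorem corollary2p1 {Θ : Type*} [NormedAddCommGroup Θ] [NormedSpace ℝ Θ] [CompleteSpace Θ]
    [MeasurableSpace Θ] [BorelSpace Θ]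
    {𝒳 : ℕ → Type*} [∀ n, MeasurableSpace (𝒳 n)]
    {k : ℕ} {Λ : Set (EuclideanSpace ℝ (Fin k))} (S : EBSetup Θ 𝒳 Λ)
    (lhat : ∀ n, 𝒳 n → Λ) (lhat_measurable : ∀ n, Measurable (lhat n))
    (lhat_mmle : ∀ᶠ n : ℕ in atTop, S.IsMMLE n (lhat n))
    (lhat_mem : Tendsto (fun n => S.P n S.θ₀ {x | lhat n x ∉ S.Λ₀ n}) atTop (𝓝 0))
    (hC : S.CondC) (hB1 : S.CondB1) (hN : S.CondEntropy) :
    ∃ M : ℝ, 0 < M ∧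
      Tendsto (fun n : ℕ => ∫⁻ x, S.posterior n (lhat n x) x
          {θ | M * S.M n * S.ε₀ n ≤ S.d θ S.θ₀} ∂(S.P n S.θ₀)) atTop (𝓝 0) := by
  obtain ⟨L, M₁, M₂, hM₁, hM₂, hB1⟩ := hB1
  obtain ⟨C', hN⟩ := hN
  set C : ℝ := max C' 0
  have hC0 : 0 ≤ C := le_max_right _ _
  have hc₀ := S.one_le_c₀
  set c : ℝ := S.c₀ * M₁ ^ 2 + 2 * (M₁ * M₂) ^ 2 + 1
  have hc : 0 ≤ c := by positivity
  -- Neither c nor C involves the sieves, so c₂ can be fixed before the constants that depend on it.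
  obtain ⟨A, c₁, ζ, M', C₀, hc₁, -, hζ, -, hM', hC₀, hC1, hC2, hC3⟩ :=
    hC (c + C + 1) (by positivity)
  refine ⟨M' + C₀ + 1, by positivity, ?_⟩
  set t : ℕ → ℝ := fun n => n * S.ε₀ n ^ 2
  have ht : Tendsto t atTop atTop := S.tendsto_mul_sq_ε₀
  have hexp : Tendsto (fun n => 2 * ENNReal.ofReal (Real.exp (-t n))) atTop (𝓝 0) := by
    simpa using ENNReal.Tendsto.const_mul (a := 2) (ENNReal.tendsto_ofReal
      (Real.tendsto_exp_neg_atTop_nhds_zero.comp ht)) (Or.inr (by simp))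
  have hinv : Tendsto (fun n => 2 * ENNReal.ofReal ((M₁ * M₂) ^ 2 * t n)⁻¹) atTop (𝓝 0) := by
    simpa using ENNReal.Tendsto.const_mul (a := 2) (ENNReal.tendsto_ofReal
      (tendsto_inv_atTop_zero.comp (ht.const_mul_atTop (by positivity : 0 < (M₁ * M₂) ^ 2))))
      (Or.inr (by simp))
  have hlim := lhat_mem.add (hinv.add (hexp.add hexp))
  simp only [add_zero] at hlim
  -- Since M_n → ∞, the testing exponent c₁ n u² / 2 eventually exceeds (c + C + 1) t, however small
  -- c₁ and M' are.
  have hMn : ∀ᶠ n in atTop, c + C + 1 ≤ c₁ * M' ^ 2 / 2 * S.M n ^ 2 :=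
    (((tendsto_pow_atTop two_ne_zero).comp S.tendsto_M).const_mul_atTop
      (by positivity : 0 < c₁ * M' ^ 2 / 2)).eventually_ge_atTop _
  refine tendsto_of_tendsto_of_tendsto_of_le_of_le' tendsto_const_nhds hlim
    (Eventually.of_forall fun _ => zero_le) ?_
  filter_upwards [lhat_mmle, hB1, hN, hC1, hC2, hC3, S.prior_ball, hMn,
    ht.eventually_ge_atTop 1, S.tendsto_M.eventually_gt_atTop 0]
    with n hmmle ⟨hLΛ, hLsub, l₀, hl₀, hεl₀⟩ hN hC1 hC2 hC3 hprior hMn ht1 hMpos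
  have hε₀ : 0 < S.ε₀ n := by
    refine (Real.sqrt_nonneg _).lt_of_ne fun h => ?_
    have h0 : S.ε₀ n = 0 := h.symm
    simp only [t, h0] at ht1
    norm_num at ht1
  set u : ℝ := M' * S.M n * S.ε₀ n with hu_def
  have hu : 0 < u := by positivity
  obtain ⟨E, hEm, hPE, hE⟩ := S.exists_p_le_marginal hM₂ hεl₀ (hLsub l₀ hl₀)
    (hprior l₀ (hLΛ hl₀).1).1 ht1 hM₁
  have hN' := hN.trans (ENNReal.ofReal_le_ofReal (Real.exp_le_exp.2
    (show C' * n * S.ε₀ n ^ 2 ≤ C * t n by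
      rw [mul_assoc]
      exact mul_le_mul_of_nonneg_right (le_max_left _ _) (by positivity))))
  obtain ⟨I, hIΛ, hIcov, hIcard⟩ := exists_finset_cover_of_coveringNumberOf_le hN'
  choose! φ hφm hφ1 hφI hφII using fun i (hi : i ∈ I) =>
    S.exists_test_of_shells n i hc₁ hζ hu (hC2 i (hIΛ i hi)).1 (hC2 i (hIΛ i hi)).2
  refine (S.lintegral_posterior_le hmmle (measurableSet_le measurable_const S.measurable_d) hEm
    (hLΛ hl₀).1 hE (fun i hi => (hIΛ i hi).1) hIcov (A := A n) (u := u) ?_ hφm hφ1 hφI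
    (fun i hi => (hC1 i (hIΛ i hi)).2) hφII).trans ?_
  -- A sieve point closer than u to θ₀ is moved by at most C₀ M_n ε₀, so its image stays within (M'
  -- + C₀) M_n ε₀ and misses the far set.
  · intro i hi l hl hρ θ hθ
    by_contra hcon
    simp only [Set.mem_union, Set.mem_compl_iff, Set.mem_ofPred_eq, not_or, not_not, not_le] at hcon
    have h1 := hC3 i (hIΛ i hi) θ hcon.1 ((S.isSemimetric_d.symm _ _).trans_le hcon.2.le) l hl.1 hρ
    have h2 := S.isSemimetric_d.triangle (S.ψ n i l θ) θ S.θ₀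
    rw [S.isSemimetric_d.symm _ θ] at h2
    have h3 : (M' + C₀ + 1) * S.M n * S.ε₀ n ≤ S.d (S.ψ n i l θ) S.θ₀ := hθ
    have h4 : 0 < S.M n * S.ε₀ n := by positivity
    have h5 := hcon.2
    rw [hu_def] at h5
    linarith
  · have ha : (c + C + 1) * t n ≤ c₁ * n * u ^ 2 / 2 := by
      calc (c + C + 1) * t n ≤ c₁ * M' ^ 2 / 2 * S.M n ^ 2 * t n := by gcongr
        _ = _ := by simp only [hu_def, t]; ring
    set r : ℝ≥0∞ := ENNReal.ofReal (Real.exp (-(c₁ * n * u ^ 2 / 2)))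
    have hr : r ≤ ENNReal.ofReal (Real.exp (-((c + C + 1) * t n))) := by
      refine ENNReal.ofReal_le_ofReal (Real.exp_le_exp.2 (neg_le_neg ha))
    have hr2 : (1 - r)⁻¹ ≤ 2 := by
      have h1 : r ≤ 2⁻¹ := by
        have h2 : (1 : ℝ) ≤ (c + C + 1) * t n := by nlinarith
        refine hr.trans ?_
        rw [Real.exp_neg, ENNReal.ofReal_inv_of_pos (Real.exp_pos _), ENNReal.inv_le_inv]
        refine ENNReal.ofNat_le_ofReal.2 ?_
        linarith [Real.add_one_le_exp ((c + C + 1) * t n)]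
      rw [ENNReal.inv_le_iff_inv_le, ← ENNReal.one_sub_inv_two]
      exact tsub_le_tsub_left h1 1
    refine add_le_add le_rfl (add_le_add hPE (add_le_add ?_ ?_))
    · calc (I.card : ℝ≥0∞) * (r * (1 - r)⁻¹)
          ≤ ENNReal.ofReal (Real.exp (C * t n)) *
            (ENNReal.ofReal (Real.exp (-((c + C + 1) * t n))) * 2) := by gcongr
        _ = 2 * ENNReal.ofReal (Real.exp (C * t n + -((c + C + 1) * t n))) := by
            rw [Real.exp_add, ENNReal.ofReal_mul (Real.exp_pos _).le]
            ring
        _ ≤ 2 * ENNReal.ofReal (Real.exp (-t n)) := by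
            gcongr
            nlinarith
    · have hβ : ENNReal.ofReal (Real.exp (-((c + C + 1) * n * S.ε₀ n ^ 2))) =
          ENNReal.ofReal (Real.exp (-((c + C + 1) * t n))) := by rw [mul_assoc]
      rw [hβ]
      -- The three exponents c, C and -(c + C + 1) add up to -1.
      calc _ ≤ ENNReal.ofReal (Real.exp (c * t n)) * (ENNReal.ofReal (Real.exp (C * t n)) *
            (ENNReal.ofReal (Real.exp (-((c + C + 1) * t n))) +
              ENNReal.ofReal (Real.exp (-((c + C + 1) * t n))))) := by gcongr
        _ = 2 * ENNReal.ofReal (Real.exp (c * t n + (C * t n + -((c + C + 1) * t n)))) := by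
            rw [Real.exp_add, Real.exp_add, ENNReal.ofReal_mul (Real.exp_pos _).le,
              ENNReal.ofReal_mul (Real.exp_pos _).le]
            ring
        _ = 2 * ENNReal.ofReal (Real.exp (-t n)) := by
            congr 3
            ring
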